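/- Conventions. Let $\varepsilon=\{\varepsilon_n\}_{n\in\mathbb Z}$ be white noise in $\mathbb R^m$ started at time $1$: $\varepsilon_n=0$ a.s. for $n\le 0$, and $\{\varepsilon_n\}_{n\ge1}$ is square integrable, has mean zero and a common covariance matrix, and is uncorrelated over time. A process $Y$ with finite second moments and zero initial values is called stationary if its mean $\mathbb E[Y_n]$ and its autocovariances $\operatorname{Cov}(Y_{n+h},Y_n)$, $h\ge 0$, converge as $n\to\infty$ (second-order stationarity up to the effect of the zero starting values). Write $\Delta Y_n=Y_n-Y_{n-1}$ and $Y\sim \mathsf I(d)$ if $d$ is the smallest natural number for which $\Delta^dY$ is stationary. For $\theta(z)=\sum_{j\ge0}\theta_jz^j$ with $m\times m$ matrix coefficients satisfying $\sum_j\|\theta_j\|<\infty$, put $\theta(B)\varepsilon_n=\sum_{j\ge0}\theta_j\varepsilon_{n-j}$ and $\theta(1)=\sum_{j\ge0}\theta_j$. Proposition. Let $\{X_n\}_{n\in\mathbb Z}$ be a square-integrable, zero-mean, non-stationary process in $\mathbb R^m$ with $X_n=0$ a.s. for $n\le0$, which follows a VAR model $X_n=\sum_{j=1}^pA_jX_{n-j}+\varepsilon_n$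 and is cointegrated of order $(1,1)$ with rank $r$: every coordinate of $X$ is $\mathsf I(1)$, there is a nonzero $b\in\mathbb R^m$ with $b'X\sim\mathsf I(0)$ (a cointegration vector), and the cointegration space spanned by all such $b$ has dimension $r$. Let $\beta\in\mathbb R^{m\times r}$ have the cointegration space as its column space, let $\beta_\perp\in\mathbb R^{m\times(m-r)}$ have rank $m-r$ and satisfy $\beta'\beta_\perp=0$, and let $P_\beta,P_{\beta_\perp}$ be the orthogonal projections onto $\operatorname{Col}\beta$ and $\operatorname{Col}\beta_\perp$. Then there are $\theta$ as above and a stationary process $\{\eta_n\}_{n\in\mathbb Z}$ in $\mathbb R^m$ such that: 1. $Z_n:=P_\beta X_n+P_{\beta_\perp}\Delta X_n$ has the moving average representation $Z_n=\theta(B)\varepsilon_n$ for all $n$, a.s.; 2. for all $n\ge0$, a.s., $$X_n=P_{\beta_\perp}\Bigl(\theta(1)\sum_{i=1}^n\varepsilon_i\Bigr)+P_\beta X_n+\eta_n ,$$ and $\eta$ itself is of the form $\eta_n=\theta^{\star}(B)\varepsilon_n$ for all $n$, a.s., with absolutely summable coefficients; 3. $P_\beta X$ is the stationary part of $X$: the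 process $\{P_\beta X_n\}$ is stationary, and for $v\in\mathbb R^m$ the scalar series $\{v'X_n\}$ is stationary if and only if $v\in\operatorname{Col}\beta$. -/

import Mathlib

open MeasureTheory ProbabilityTheory Filter Topology

/-- The difference operator `ΔX_n = X_n - X_{n-1}`. -/
def diffOp {Ω E : Type*} [AddCommGroup E] (X : ℤ → Ω → E) : ℤ → Ω → E :=
  fun n ω => X n ω - X (n - 1) ω

/-- (Second-order) stationarity of a process started from zero initial values: the process has
finite second moments, and the mean of `Y_n` and all autocovariances of `(Y_{n+h}, Y_n)`, `h ≥ 0`,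
become independent of `n`, i.e. converge as `n → ∞`.

All processes below vanish for `n ≤ 0`. Time-independence of the moments over all of `ℤ` would
force such a process to be zero, so stationarity means, as usual for systems with zero initial
values, stationarity up to the effect of the starting values. -/
def IsStationaryProcess {Ω E : Type*} [MeasurableSpace Ω] [NormedAddCommGroup E]
    [InnerProductSpace ℝ E] (μ : Measure Ω) (Y : ℤ → Ω → E) : Prop :=
  (∀ n, MemLp (Y n) 2 μ) ∧
  (∃ a : E, Tendsto (fun n : ℤ => ∫ ω, Y n ω ∂μ) atTop (𝓝 a)) ∧
  ∀ (h : ℕ) (u v : E), ∃ γ : ℝ,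
    Tendsto (fun n : ℤ => covariance (fun ω => inner ℝ u (Y (n + h) ω))
      (fun ω => inner ℝ v (Y n ω)) μ) atTop (𝓝 γ)

/-- `Y ∼ I(d)`: `d` is the smallest natural number such that `Δ^d Y` is stationary. -/
def IsIntegrated {Ω E : Type*} [MeasurableSpace Ω] [NormedAddCommGroup E]
    [InnerProductSpace ℝ E] (μ : Measure Ω) (d : ℕ) (Y : ℤ → Ω → E) : Prop :=
  IsLeast {k : ℕ | IsStationaryProcess μ (diffOp^[k] Y)} d

/-- `b` is a cointegration vector of order `(d, c)` for `X`: `b ≠ 0` and `b'X ∼ I(d - c)`. -/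
def IsCointegrationVector {Ω : Type*} [MeasurableSpace Ω] {m : ℕ} (μ : Measure Ω) (d c : ℕ)
    (X : ℤ → Ω → EuclideanSpace ℝ (Fin m)) (b : EuclideanSpace ℝ (Fin m)) : Prop :=
  b ≠ 0 ∧ IsIntegrated μ (d - c) (fun n ω => inner ℝ b (X n ω))

/-- `X ∼ CI(d, c)`. -/
def IsCI {Ω : Type*} [MeasurableSpace Ω] {m : ℕ} (μ : Measure Ω) (d c : ℕ)
    (X : ℤ → Ω → EuclideanSpace ℝ (Fin m)) : Prop :=
  c ≤ d ∧ (∀ i : Fin m, IsIntegrated μ d (fun n ω => X n ω i)) ∧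
    ∃ b, IsCointegrationVector μ d c X b

/-- The space spanned by the cointegration vectors of a `CI(1,1)` series. -/
def cointegrationSpace {Ω : Type*} [MeasurableSpace Ω] {m : ℕ} (μ : Measure Ω)
    (X : ℤ → Ω → EuclideanSpace ℝ (Fin m)) : Submodule ℝ (EuclideanSpace ℝ (Fin m)) :=
  Submodule.span ℝ {b | IsCointegrationVector μ 1 1 X b}

/-- White noise in `ℝ^m` with zero values before time `1`: for `n ≥ 1` the variables have mean
zero, a common covariance matrix `S`, and are mutually uncorrelated. -/
structure IsWhiteNoise {Ω : Type*} [MeasurableSpace Ω] {m : ℕ} (μ : Measure Ω)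
    (ε : ℤ → Ω → EuclideanSpace ℝ (Fin m)) : Prop where
  memLp : ∀ n, MemLp (ε n) 2 μ
  start : ∀ n ≤ 0, ∀ᵐ ω ∂μ, ε n ω = 0
  mean : ∀ n, ∫ ω, ε n ω ∂μ = 0
  cov : ∃ S : Matrix (Fin m) (Fin m) ℝ, ∀ n k : ℤ, 1 ≤ n → 1 ≤ k → ∀ i j : Fin m,
    ∫ ω, ε n ω i * ε k ω j ∂μ = if n = k then S i j else 0

/-- `X` follows the vector autoregression `X_n = A_1 X_{n-1} + ⋯ + A_p X_{n-p} + ε_n`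
of order `p` with white noise `ε`. -/
def IsVAR {Ω : Type*} [MeasurableSpace Ω] {m : ℕ} (μ : Measure Ω) (p : ℕ)
    (X ε : ℤ → Ω → EuclideanSpace ℝ (Fin m)) : Prop :=
  IsWhiteNoise μ ε ∧ ∃ A : ℕ → Matrix (Fin m) (Fin m) ℝ, ∀ n : ℤ, ∀ᵐ ω ∂μ,
    X n ω = ∑ j ∈ Finset.Icc 1 p, (A j).toEuclideanLin (X (n - j) ω) + ε n ω

/-- The cointegration assumption: `X` is a square-integrable, non-stationary, zero-mean process
with `X_n = 0` a.s. for `n ≤ 0`, follows a VAR(`p`) model with noise `ε`, and is `CI(1,1)` with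
cointegration rank `r`. -/
structure CointegrationAssumption {Ω : Type*} [MeasurableSpace Ω] {m : ℕ} (μ : Measure Ω)
    (p r : ℕ) (X ε : ℤ → Ω → EuclideanSpace ℝ (Fin m)) : Prop where
  memLp : ∀ n, MemLp (X n) 2 μ
  nonstationary : ¬ IsStationaryProcess μ X
  mean : ∀ n, ∫ ω, X n ω ∂μ = 0
  start : ∀ n ≤ 0, ∀ᵐ ω ∂μ, X n ω = 0
  isVAR : IsVAR μ p X ε
  isCI : IsCI μ 1 1 X
  rank : Module.finrank ℝ (cointegrationSpace μ X) = r

/-- The column space of a real matrix. -/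
def colSpace {m k : ℕ} (B : Matrix (Fin m) (Fin k) ℝ) : Submodule ℝ (EuclideanSpace ℝ (Fin m)) :=
  Submodule.span ℝ (Set.range fun j => WithLp.toLp 2 (B.col j))

/-- The orthogonal projection `P_B` of `ℝ^m` onto the column space of `B`. -/
noncomputable def colProj {m k : ℕ} (B : Matrix (Fin m) (Fin k) ℝ) :
    EuclideanSpace ℝ (Fin m) →L[ℝ] EuclideanSpace ℝ (Fin m) :=
  (colSpace B).starProjection

/-- `Y_n = θ(B) ε_n = ∑_{j ≥ 0} θ_j ε_{n-j}` for all `n`, with absolutely summable coefficient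
matrices (`B` is the backshift operator). -/
def HasMARepresentation {Ω : Type*} [MeasurableSpace Ω] {m : ℕ} (μ : Measure Ω)
    (θ : ℕ → Matrix (Fin m) (Fin m) ℝ) (ε Y : ℤ → Ω → EuclideanSpace ℝ (Fin m)) : Prop :=
  (∀ a b : Fin m, Summable fun j => |θ j a b|) ∧
  ∀ n : ℤ, ∀ᵐ ω ∂μ, HasSum (fun j : ℕ => (θ j).toEuclideanLin (ε (n - j) ω)) (Y n ω)

/-- The value `θ(1) = ∑_{j ≥ 0} θ_j` of the power series with coefficient matrices `θ_j`. -/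
noncomputable def maSum {m : ℕ} (θ : ℕ → Matrix (Fin m) (Fin m) ℝ) : Matrix (Fin m) (Fin m) ℝ :=
  Matrix.of fun a b => ∑' j, θ j a b

/-! Zero initial values make `X` a finite moving average: `X_n = ∑_{j<n} Ψ_j ε_{n-j}`, with `Ψ_j`
the impulse responses read off powers of the companion operator. With `S` the noise covariance, the
autocovariances of a causal filter are partial sums of a fixed series. Hence if `b'X` is stationary,
the terms `⟨Ψ_j' b, S Ψ_j' b⟩` of the variance series tend to zero, and Cauchy–Schwarz gives `b'Ψ_j
S y → 0`. The same argument for `ΔX` gives `ΔΨ_j S y → 0`. These scalar sequences solve linear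
recurrences, so tending to zero forces geometric decay (`geomDecay_of_linearRecurrence`). This
replaces any analysis of the roots of the VAR polynomial. Since `S` may be singular, decay is known
only on its range; the noise lies there almost surely, so composing with the projection `N` onto
that range changes nothing. With `P = P_β` and `Q = P_β⊥`, the coefficients `T_j = (P Ψ_j + Q ΔΨ_j)
N` of `Z` are then summable. Telescoping gives `Q Ψ_j N = Q ∑_i T_i - Q ∑_{i>j} T_i`: the constant
yields the random walk, the geometric tails yield `η`. -/

open scoped BoundedContinuousFunction

/-! ### Geometrically decaying sequences. -/

/-- The sequence `a` is dominated by a geometric sequence. -/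
def GeomDecay {E : Type*} [NormedAddCommGroup E] (a : ℕ → E) : Prop :=
  ∃ K ρ : ℝ, 0 < ρ ∧ ρ < 1 ∧ ∀ n, ‖a n‖ ≤ K * ρ ^ n

namespace GeomDecay

variable {E F : Type*} [NormedAddCommGroup E] [NormedAddCommGroup F]

theorem of_norm_le {a : ℕ → E} {b : ℕ → F} (hb : GeomDecay b) (K : ℝ) (hK : 0 ≤ K)
    (h : ∀ n, ‖a n‖ ≤ K * ‖b n‖) : GeomDecay a := by
  obtain ⟨C, ρ, h0, h1, hC⟩ := hb
  refine ⟨K * C, ρ, h0, h1, fun n => (h n).trans ?_⟩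
  rw [mul_assoc]
  exact mul_le_mul_of_nonneg_left (hC n) hK

theorem add {a b : ℕ → E} (ha : GeomDecay a) (hb : GeomDecay b) :
    GeomDecay fun n => a n + b n := by
  obtain ⟨C, ρ, h0, h1, hC⟩ := ha
  obtain ⟨D, σ, g0, g1, hD⟩ := hb
  have hCnn : 0 ≤ C := by simpa using (norm_nonneg _).trans (hC 0)
  have hDnn : 0 ≤ D := by simpa using (norm_nonneg _).trans (hD 0)
  refine ⟨C + D, max ρ σ, lt_max_of_lt_left h0, max_lt h1 g1, fun n => ?_⟩
  calc ‖a n + b n‖ ≤ ‖a n‖ + ‖b n‖ := norm_add_le _ _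
    _ ≤ C * ρ ^ n + D * σ ^ n := add_le_add (hC n) (hD n)
    _ ≤ C * max ρ σ ^ n + D * max ρ σ ^ n := by
      gcongr
      · exact le_max_left _ _
      · exact le_max_right _ _
    _ = _ := by ring

theorem zero : GeomDecay fun _ : ℕ => (0 : E) :=
  ⟨0, 1 / 2, by norm_num, by norm_num, by simp⟩

theorem sum {ι : Type*} (s : Finset ι) {a : ι → ℕ → E} (h : ∀ i ∈ s, GeomDecay (a i)) :
    GeomDecay fun n => ∑ i ∈ s, a i n := by
  classical
  induction s using Finset.induction_on with
  | empty => simpa using zero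
  | insert i s hi ih =>
    simp only [Finset.sum_insert hi]
    exact (h i (by simp)).add (ih fun j hj => h j (by simp [hj]))

theorem of_succ {a : ℕ → E} (h : GeomDecay fun n => a (n + 1)) : GeomDecay a := by
  obtain ⟨C, ρ, h0, h1, hC⟩ := h
  refine ⟨max ‖a 0‖ (C / ρ), ρ, h0, h1, fun n => ?_⟩
  rcases n with _ | n
  · simp
  · calc ‖a (n + 1)‖ ≤ C * ρ ^ n := hC n
      _ = C / ρ * ρ ^ (n + 1) := by
        rw [pow_succ]
        field_simp
      _ ≤ _ := by
        gcongr
        exact le_max_right _ _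

theorem summable_norm {a : ℕ → E} (h : GeomDecay a) : Summable fun n => ‖a n‖ := by
  obtain ⟨C, ρ, h0, h1, hC⟩ := h
  exact Summable.of_nonneg_of_le (fun _ => norm_nonneg _) hC
    ((summable_geometric_of_lt_one h0.le h1).mul_left C)

theorem tail [CompleteSpace E] {a : ℕ → E} (h : GeomDecay a) :
    GeomDecay fun n => ∑' k, a (k + (n + 1)) := by
  obtain ⟨C, ρ, h0, h1, hC⟩ := h
  refine ⟨C * ρ * (1 - ρ)⁻¹, ρ, h0, h1, fun n => ?_⟩
  refine tsum_of_norm_bounded (g := fun k => C * ρ ^ (n + 1) * ρ ^ k) ?_ fun k => ?_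
  · have := (hasSum_geometric_of_lt_one h0.le h1).mul_left (C * ρ ^ (n + 1))
    rwa [show C * ρ ^ (n + 1) * (1 - ρ)⁻¹ = C * ρ * (1 - ρ)⁻¹ * ρ ^ n by ring] at this
  · refine (hC _).trans_eq ?_
    rw [pow_add, mul_assoc, mul_comm (ρ ^ k)]

variable [NormedSpace ℝ E] [NormedSpace ℝ F]

theorem map (L : E →L[ℝ] F) {a : ℕ → E} (h : GeomDecay a) : GeomDecay fun n => L (a n) :=
  h.of_norm_le ‖L‖ (norm_nonneg _) fun n => L.le_opNorm (a n)

/-- On a finite dimensional space, pointwise geometric decay of operators is uniform. -/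
theorem of_apply [FiniteDimensional ℝ E] {T : ℕ → E →L[ℝ] F}
    (h : ∀ x, GeomDecay fun n => T n x) : GeomDecay T := by
  let v := Module.finBasis ℝ E
  obtain ⟨C, hC, hv⟩ := v.exists_opNorm_le (F := F)
  have hs : GeomDecay fun n => ∑ i, ‖T n (v i)‖ :=
    sum (a := fun i n => ‖T n (v i)‖) _ fun i _ =>
      (h (v i)).of_norm_le (a := fun n => ‖T n (v i)‖) 1 zero_le_one fun n => by simp
  refine hs.of_norm_le C hC.le fun n => hv (Finset.sum_nonneg fun _ _ => norm_nonneg _)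
    (fun i => Finset.single_le_sum (f := fun i => ‖T n (v i)‖) (fun _ _ => norm_nonneg _)
      (Finset.mem_univ i)) |>.trans (mul_le_mul_of_nonneg_left (le_abs_self _) hC.le)

end GeomDecay

/-! ### Null linear recurrences decay geometrically. -/

/-- The powers of an operator on a finite dimensional space that converge pointwise to zero
decay geometrically. -/
theorem geomDecay_pow_of_tendsto {W : Type*} [NormedAddCommGroup W] [NormedSpace ℝ W]
    [FiniteDimensional ℝ W] (T : W →L[ℝ] W)
    (h : ∀ w, Tendsto (fun n => (T ^ n) w) atTop (𝓝 0)) : GeomDecay fun n => T ^ n := by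
  let v := Module.finBasis ℝ W
  obtain ⟨C, hC, hv⟩ := v.exists_opNorm_le (F := W)
  have hs : Tendsto (fun n => C * ∑ i, ‖(T ^ n) (v i)‖) atTop (𝓝 0) := by
    have := (tendsto_finsetSum Finset.univ fun i _ => (h (v i)).norm).const_mul C
    simpa using this
  obtain ⟨N, hN⟩ := (hs.eventually_lt_const (show (0 : ℝ) < 1 / 2 by norm_num)).exists_forall_of_atTop
  have hle : ∀ n, ‖T ^ n‖ ≤ C * ∑ i, ‖(T ^ n) (v i)‖ := fun n =>
    hv (Finset.sum_nonneg fun _ _ => norm_nonneg _) fun i =>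
      Finset.single_le_sum (f := fun i => ‖(T ^ n) (v i)‖) (fun _ _ => norm_nonneg _)
        (Finset.mem_univ i)
  -- A single power of norm at most 1/2 suffices: `ρ` is the `q`-th root of 1/2, `D` bounds the
  -- powers below `q`, and dividing by `ρ ^ q` absorbs the remainder `n % q`.
  have hT : ‖T ^ (N + 1)‖ ≤ 1 / 2 := (hle _).trans (hN _ (by omega)).le
  set q := N + 1 with hq
  have hq0 : (0 : ℝ) < q := by positivity
  set ρ : ℝ := (1 / 2 : ℝ) ^ (1 / (q : ℝ)) with hρ
  have hρ0 : 0 < ρ := by positivity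
  have hρ1 : ρ < 1 := Real.rpow_lt_one (by norm_num) (by norm_num) (by positivity)
  have hρq : ρ ^ q = 1 / 2 := by
    rw [hρ, ← Real.rpow_natCast, ← Real.rpow_mul (by norm_num), one_div_mul_cancel hq0.ne',
      Real.rpow_one]
  set D : ℝ := ∑ k ∈ Finset.range q, ‖T ^ k‖ with hD
  have hDnn : 0 ≤ D := Finset.sum_nonneg fun _ _ => norm_nonneg _
  refine ⟨D / ρ ^ q, ρ, hρ0, hρ1, fun n => ?_⟩
  have hkey : ∀ k, ‖(T ^ q) ^ k * T ^ (n % q)‖ ≤ (1 / 2) ^ k * D := by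
    intro k
    induction k with
    | zero =>
      simpa using Finset.single_le_sum (f := fun k => ‖T ^ k‖) (fun _ _ => norm_nonneg _)
        (Finset.mem_range.2 (Nat.mod_lt n (by omega)))
    | succ k ih =>
      rw [pow_succ', mul_assoc, pow_succ' (1 / 2 : ℝ), mul_assoc]
      exact (norm_mul_le _ _).trans (mul_le_mul hT ih (norm_nonneg _) (by norm_num))
  have h1 : T ^ n = (T ^ q) ^ (n / q) * T ^ (n % q) := by
    rw [← pow_mul, ← pow_add, Nat.div_add_mod]
  have h2 : ρ ^ n = (1 / 2) ^ (n / q) * ρ ^ (n % q) := by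
    rw [← hρq, ← pow_mul, ← pow_add, Nat.div_add_mod]
  rw [h2]
  refine (h1 ▸ hkey (n / q)).trans ?_
  have h3 : ρ ^ q ≤ ρ ^ (n % q) :=
    pow_le_pow_of_le_one hρ0.le hρ1.le (Nat.mod_lt n (by omega)).le
  have h4 : 0 < ρ ^ q := by positivity
  calc (1 / 2 : ℝ) ^ (n / q) * D = D / ρ ^ q * ((1 / 2) ^ (n / q) * ρ ^ q) := by
        field_simp
    _ ≤ _ := by gcongr

/-- On a finite dimensional invariant subspace, convergence of the iterates of an operator to zero
is geometric. -/
theorem geomDecay_pow_apply_of_tendsto {E : Type*} [NormedAddCommGroup E] [NormedSpace ℝ E]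
    (σ : E →ₗ[ℝ] E) (W : Submodule ℝ E) [FiniteDimensional ℝ W] (hσ : ∀ w ∈ W, σ w ∈ W)
    (h : ∀ w ∈ W, Tendsto (fun n => (σ ^ n) w) atTop (𝓝 0)) (w : E) (hw : w ∈ W) :
    GeomDecay fun n => (σ ^ n) w := by
  let T : W →L[ℝ] W := LinearMap.toContinuousLinearMap (σ.restrict hσ)
  have hTn : ∀ (w : W) (n : ℕ), ((T ^ n) w : E) = (σ ^ n) w := by
    intro w n
    induction n with
    | zero => simp
    | succ n ih =>
      rw [pow_succ', pow_succ']
      change σ ((T ^ n) w : E) = σ ((σ ^ n) w)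
      rw [ih]
  have hT : GeomDecay fun n => T ^ n := geomDecay_pow_of_tendsto T fun w => by
    rw [tendsto_subtype_rng]
    simpa only [hTn, ZeroMemClass.coe_zero] using h w w.2
  refine hT.of_norm_le ‖w‖ (norm_nonneg _) fun n => ?_
  rw [← hTn ⟨w, hw⟩ n, mul_comm]
  exact (T ^ n).le_opNorm _

/-- A linear recurrent sequence that converges to zero decays geometrically. -/
theorem geomDecay_of_linearRecurrence {V : Type*} [AddCommGroup V] [Module ℝ V]
    [FiniteDimensional ℝ V] (M : V →ₗ[ℝ] V) (x : V) (L : V →ₗ[ℝ] ℝ)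
    (h : Tendsto (fun n => L ((M ^ n) x)) atTop (𝓝 0)) : GeomDecay fun n => L ((M ^ n) x) := by
  let F : (V →ₗ[ℝ] ℝ) →ₗ[ℝ] (ℕ → ℝ) :=
    { toFun := fun g n => g ((M ^ n) x)
      map_add' := fun _ _ => rfl
      map_smul' := fun _ _ => rfl }
  -- The range of `F` is finite dimensional and shift invariant (replace `g` by `g ∘ₗ M`). `W`
  -- collects its null sequences, under the sup norm.
  obtain ⟨W, hW⟩ : ∃ W : Submodule ℝ (ℕ →ᵇ ℝ),
      ∀ f, f ∈ W ↔ Tendsto f atTop (𝓝 0) ∧ ⇑f ∈ LinearMap.range F := by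
    refine ⟨
      { carrier := {f | Tendsto f atTop (𝓝 0) ∧ ⇑f ∈ LinearMap.range F}
        zero_mem' := ⟨tendsto_const_nhds, by
          rw [BoundedContinuousFunction.coe_zero]; exact zero_mem _⟩
        add_mem' := fun {f g} hf hg => ⟨by
          have := hf.1.add hg.1
          rwa [add_zero] at this, by
          rw [BoundedContinuousFunction.coe_add]; exact add_mem hf.2 hg.2⟩
        smul_mem' := fun c f hf => ⟨by
          have := hf.1.const_mul c
          rwa [mul_zero] at this, by
          rw [BoundedContinuousFunction.coe_smul]; exact Submodule.smul_mem _ c hf.2⟩ },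
      fun f => Iff.rfl⟩
  have : FiniteDimensional ℝ W := by
    let ι : W →ₗ[ℝ] LinearMap.range F :=
      { toFun := fun f => ⟨⇑f.1, ((hW _).1 f.2).2⟩
        map_add' := fun _ _ => rfl
        map_smul' := fun _ _ => rfl }
    refine Module.Finite.of_injective ι fun f g hfg => ?_
    exact Subtype.ext (DFunLike.coe_injective (congrArg Subtype.val hfg))
  let σ : (ℕ →ᵇ ℝ) →ₗ[ℝ] (ℕ →ᵇ ℝ) :=
    { toFun := fun f => f.compContinuous ⟨Nat.succ, continuous_of_discreteTopology⟩
      map_add' := fun _ _ => rfl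
      map_smul' := fun _ _ => rfl }
  have hσn : ∀ (n : ℕ) (f : ℕ →ᵇ ℝ) (k : ℕ), (σ ^ n) f k = f (n + k) := by
    intro n f
    induction n with
    | zero => intro k; simp
    | succ n ih =>
      intro k
      rw [pow_succ']
      change (σ ^ n) f (k + 1) = _
      rw [ih]
      congr 1
      omega
  let f₀ : ℕ →ᵇ ℝ := BoundedContinuousFunction.mkOfBound
    ⟨fun n => L ((M ^ n) x), continuous_of_discreteTopology⟩
    (Classical.choose (Metric.isBounded_range_iff.1 (Metric.isBounded_range_of_tendsto _ h)))
    (Classical.choose_spec (Metric.isBounded_range_iff.1 (Metric.isBounded_range_of_tendsto _ h)))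
  have hw : f₀ ∈ W := (hW _).2 ⟨h, L, rfl⟩
  have hdecay := geomDecay_pow_apply_of_tendsto σ W (fun f hf => ?_) (fun f hf => ?_) f₀ hw
  · refine hdecay.of_norm_le 1 zero_le_one fun n => ?_
    rw [one_mul]
    refine le_trans (le_of_eq ?_) (((σ ^ n) f₀).norm_coe_le_norm 0)
    rw [hσn]
    rfl
  · obtain ⟨hf, g, hg⟩ := (hW _).1 hf
    refine (hW _).2 ⟨hf.comp (tendsto_add_atTop_nat 1), g ∘ₗ M, funext fun n => ?_⟩
    have := congrFun hg (n + 1)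
    simp only [F, LinearMap.coe_mk, AddHom.coe_mk] at this ⊢
    rw [pow_succ'] at this
    exact this
  -- The sup norm of the `n`-th shift is the supremum of the tail from `n` on, which vanishes for a
  -- null sequence.
  · rw [Metric.tendsto_atTop]
    intro e he
    obtain ⟨N, hN⟩ := Metric.tendsto_atTop.1 ((hW _).1 hf).1 (e / 2) (half_pos he)
    refine ⟨N, fun n hn => ?_⟩
    rw [dist_zero_right]
    refine lt_of_le_of_lt ?_ (half_lt_self he)
    refine (BoundedContinuousFunction.norm_le (half_pos he).le).2 fun k => ?_
    rw [hσn, ← dist_zero_right]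
    exact (hN (n + k) (by omega)).le

/-! ### Covariance operator and support of the noise. -/

section WhiteNoise

variable {Ω : Type*} [MeasurableSpace Ω] {μ : Measure Ω} {m : ℕ}
  {ε : ℤ → Ω → EuclideanSpace ℝ (Fin m)}

/-- `S` is the covariance operator of the white noise `ε`. -/
structure IsNoiseCov (μ : Measure Ω) (ε : ℤ → Ω → EuclideanSpace ℝ (Fin m))
    (S : EuclideanSpace ℝ (Fin m) →L[ℝ] EuclideanSpace ℝ (Fin m)) : Prop where
  cov : ∀ s t : ℤ, 1 ≤ s → 1 ≤ t → ∀ a b : EuclideanSpace ℝ (Fin m),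
    covariance (fun ω => inner ℝ a (ε s ω)) (fun ω => inner ℝ b (ε t ω)) μ
      = if s = t then inner ℝ a (S b) else 0

theorem IsWhiteNoise.memLp_inner (hε : IsWhiteNoise μ ε) (a : EuclideanSpace ℝ (Fin m)) (n : ℤ) :
    MemLp (fun ω => inner ℝ a (ε n ω)) 2 μ :=
  (innerSL ℝ a).comp_memLp' (hε.memLp n)

variable {S : EuclideanSpace ℝ (Fin m) →L[ℝ] EuclideanSpace ℝ (Fin m)}

theorem IsNoiseCov.symm (hS : IsNoiseCov μ ε S) (a b : EuclideanSpace ℝ (Fin m)) :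
    inner ℝ a (S b) = inner ℝ b (S a) := by
  have h1 := hS.cov 1 1 le_rfl le_rfl a b
  have h2 := hS.cov 1 1 le_rfl le_rfl b a
  rw [covariance_comm] at h1
  simp only [if_true] at h1 h2
  rw [← h1, ← h2]

theorem IsNoiseCov.nonneg (hS : IsNoiseCov μ ε S) (hε : IsWhiteNoise μ ε)
    (a : EuclideanSpace ℝ (Fin m)) : 0 ≤ inner ℝ a (S a) := by
  have h1 := hS.cov 1 1 le_rfl le_rfl a a
  simp only [if_true] at h1
  rw [← h1, covariance_self (hε.memLp_inner a 1).aemeasurable]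
  exact variance_nonneg _ _

variable [IsProbabilityMeasure μ]

theorem IsWhiteNoise.integral_inner (hε : IsWhiteNoise μ ε) (a : EuclideanSpace ℝ (Fin m)) (n : ℤ) :
    ∫ ω, inner ℝ a (ε n ω) ∂μ = 0 := by
  have := (innerSL ℝ a).integral_comp_comm ((hε.memLp n).integrable (by norm_num))
  simpa [hε.mean n] using this

theorem IsWhiteNoise.exists_isNoiseCov (hε : IsWhiteNoise μ ε) : ∃ S, IsNoiseCov μ ε S := by
  obtain ⟨S, hS⟩ := hε.cov
  have hcoord : ∀ (n : ℤ) (i : Fin m), MemLp (fun ω => ε n ω i) 2 μ := fun n i => by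
    simpa [EuclideanSpace.inner_single_left] using hε.memLp_inner (EuclideanSpace.single i 1) n
  have hcoord0 : ∀ (n : ℤ) (i : Fin m), ∫ ω, ε n ω i ∂μ = 0 := fun n i => by
    simpa [EuclideanSpace.inner_single_left] using hε.integral_inner (EuclideanSpace.single i 1) n
  refine ⟨LinearMap.toContinuousLinearMap S.toEuclideanLin, ⟨fun s t hs ht a b => ?_⟩⟩
  have hsum : ∀ (a : EuclideanSpace ℝ (Fin m)) (n : ℤ), (fun ω => inner ℝ a (ε n ω))
      = fun ω => ∑ i, a i * ε n ω i := fun a n => by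
    funext ω
    simp [PiLp.inner_apply, mul_comm]
  rw [hsum, hsum, covariance_fun_sum_fun_sum (fun i => (hcoord s i).const_mul (a i))
    (fun i => (hcoord t i).const_mul (b i))]
  have hij : ∀ i j, covariance (fun ω => a i * ε s ω i) (fun ω => b j * ε t ω j) μ
      = a i * (b j * if s = t then S i j else 0) := fun i j => by
    rw [covariance_const_mul_left, covariance_const_mul_right,
      covariance_eq_sub (hcoord s i) (hcoord t j), hcoord0, zero_mul, sub_zero, ← hS s t hs ht i j]
    rfl
  simp only [hij]
  split_ifs with h
  · simp [PiLp.inner_apply, Matrix.toLpLin_apply, Matrix.mulVec, dotProduct,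
      Finset.mul_sum, mul_comm, mul_left_comm]
  · simp

-- Cauchy–Schwarz for the semi-inner product defined by `S`; it turns control of variances into
-- control of the coefficients on the range of `S`.
omit [IsProbabilityMeasure μ] in
theorem IsNoiseCov.inner_sq_le (hS : IsNoiseCov μ ε S) (hε : IsWhiteNoise μ ε)
    (a b : EuclideanSpace ℝ (Fin m)) :
    (inner ℝ a (S b)) ^ 2 ≤ inner ℝ a (S a) * inner ℝ b (S b) := by
  let B : LinearMap.BilinForm ℝ (EuclideanSpace ℝ (Fin m)) :=
    LinearMap.mk₂ ℝ (fun a b => inner ℝ a (S b)) (fun _ _ _ => inner_add_left _ _ _)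
      (fun c a b => by simp [inner_smul_left]) (fun _ _ _ => by simp [inner_add_right])
      (fun c a b => by simp [inner_smul_right])
  exact B.apply_sq_le_of_symm (fun x => hS.nonneg hε x) ⟨fun x y => hS.symm x y⟩ a b

/-- For `a` orthogonal to the range of `S`, the mean-zero variable `⟨a, ε_n⟩` has variance `⟨a, S a⟩
= 0`. A finite basis of the orthogonal complement leaves one null set for each `n`. -/
theorem IsNoiseCov.ae_mem_range (hS : IsNoiseCov μ ε S) (hε : IsWhiteNoise μ ε) :
    ∀ᵐ ω ∂μ, ∀ n, S.range.starProjection (ε n ω) = ε n ω := by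
  rw [ae_all_iff]
  intro n
  rcases le_or_gt n 0 with hn | hn
  · filter_upwards [hε.start n hn] with ω hω
    simp [hω]
  have key : ∀ a ∈ S.rangeᗮ, ∀ᵐ ω ∂μ, inner ℝ a (ε n ω) = (0 : ℝ) := by
    intro a ha
    have h1 := hS.cov n n hn hn a a
    have h0 : inner ℝ a (S a) = (0 : ℝ) :=
      (Submodule.mem_orthogonal' _ _).1 ha _ (LinearMap.mem_range_self _ a)
    rw [if_pos rfl, h0, covariance_self (hε.memLp_inner a n).aemeasurable] at h1
    have h2 := (evariance_eq_zero_iff (hε.memLp_inner a n).aemeasurable).1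
      ((ENNReal.toReal_eq_zero_iff _).1 h1 |>.resolve_right
        (hε.memLp_inner a n).evariance_lt_top.ne)
    filter_upwards [h2] with ω hω
    rw [hω, hε.integral_inner]
  let b := Module.finBasis ℝ S.rangeᗮ
  have hb : ∀ᵐ ω ∂μ, ∀ i, inner ℝ (b i : EuclideanSpace ℝ (Fin m)) (ε n ω) = (0 : ℝ) :=
    ae_all_iff.2 fun i => key _ (b i).2
  filter_upwards [hb] with ω hω
  rw [Submodule.starProjection_eq_self_iff, ← Submodule.orthogonal_orthogonal S.range,
    Submodule.mem_orthogonal]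
  intro u hu
  have : ((innerₛₗ ℝ).flip (ε n ω)) ∘ₗ S.rangeᗮ.subtype = 0 := b.ext fun i => by
    simpa using hω i
  simpa using LinearMap.congr_fun this ⟨u, hu⟩

end WhiteNoise

theorem covariance_congr_ae {Ω : Type*} [MeasurableSpace Ω] {μ : Measure Ω} {X X' Y Y' : Ω → ℝ}
    (hX : X =ᵐ[μ] X') (hY : Y =ᵐ[μ] Y') : covariance X Y μ = covariance X' Y' μ := by
  rw [covariance, covariance, integral_congr_ae hX, integral_congr_ae hY]
  refine integral_congr_ae ?_
  filter_upwards [hX, hY] with ω h1 h2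
  rw [h1, h2]

/-! ### Algebra of finite moving averages. -/

section CausalFilter

variable {Ω E F G : Type*} [MeasurableSpace Ω] {μ : Measure Ω}
  [NormedAddCommGroup E] [NormedSpace ℝ E] [NormedAddCommGroup F] [NormedSpace ℝ F]
  [NormedAddCommGroup G] [NormedSpace ℝ G]

/-- `Y_n = ∑_{0 ≤ j < n} C_j ε_{n-j}` a.s. for all `n`. -/
def IsCausalFilter (μ : Measure Ω) (C : ℕ → E →L[ℝ] F) (ε : ℤ → Ω → E) (Y : ℤ → Ω → F) : Prop :=
  ∀ n : ℤ, ∀ᵐ ω ∂μ, Y n ω = ∑ j ∈ Finset.range n.toNat, C j (ε (n - j) ω)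

/-- The coefficients of the difference of a causal filter. -/
def diffCoeff (C : ℕ → E →L[ℝ] F) : ℕ → E →L[ℝ] F
  | 0 => C 0
  | n + 1 => C (n + 1) - C n

theorem sum_diffCoeff (C : ℕ → E →L[ℝ] F) (n : ℕ) :
    ∑ j ∈ Finset.range (n + 1), diffCoeff C j = C n := by
  rw [Finset.sum_range_succ']
  simp only [diffCoeff]
  rw [Finset.sum_range_sub, sub_add_cancel]

namespace IsCausalFilter

variable {C D : ℕ → E →L[ℝ] F} {ε : ℤ → Ω → E} {Y Z : ℤ → Ω → F}

theorem map (L : F →L[ℝ] G) (h : IsCausalFilter μ C ε Y) :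
    IsCausalFilter μ (fun j => L ∘L C j) ε fun n ω => L (Y n ω) := fun n => by
  filter_upwards [h n] with ω hω
  simp [hω, map_sum]

theorem add (h : IsCausalFilter μ C ε Y) (h' : IsCausalFilter μ D ε Z) :
    IsCausalFilter μ (fun j => C j + D j) ε fun n ω => Y n ω + Z n ω := fun n => by
  filter_upwards [h n, h' n] with ω hω hω'
  simp [hω, hω', Finset.sum_add_distrib]

/-- Coefficients may be altered off the support of the noise, where no decay is available. -/
theorem comp_right (P : E →L[ℝ] E) (hP : ∀ᵐ ω ∂μ, ∀ n, P (ε n ω) = ε n ω)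
    (h : IsCausalFilter μ C ε Y) : IsCausalFilter μ (fun j => C j ∘L P) ε Y := fun n => by
  filter_upwards [h n, hP] with ω hω hω'
  simp [hω, hω']

theorem diffOp (h : IsCausalFilter μ C ε Y) : IsCausalFilter μ (diffCoeff C) ε (diffOp Y) :=
    fun n => by
  filter_upwards [h n, h (n - 1)] with ω h1 h2
  simp only [_root_.diffOp, h1, h2]
  rcases le_or_gt n 0 with hn | hn
  · simp [Int.toNat_of_nonpos hn, Int.toNat_of_nonpos (show n - 1 ≤ 0 by omega)]
  · obtain ⟨k, rfl⟩ : ∃ k : ℕ, n = k + 1 := ⟨(n - 1).toNat, by omega⟩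
    have e1 : ((k : ℤ) + 1).toNat = k + 1 := by omega
    have e2 : ((k : ℤ) + 1 - 1).toNat = k := by omega
    rw [e1, e2, Finset.sum_range_succ', Finset.sum_range_succ' (fun j => diffCoeff C j _),
      add_sub_right_comm, ← Finset.sum_sub_distrib]
    congr 1
    refine Finset.sum_congr rfl fun j _ => ?_
    have e3 : (k : ℤ) + 1 - ((j + 1 : ℕ) : ℤ) = k + 1 - 1 - j := by push_cast; ring
    rw [e3]
    rfl

end IsCausalFilter

end CausalFilter

/-! ### Stationarity in terms of filter coefficients. -/

section Stationary

variable {Ω F : Type*} [MeasurableSpace Ω] {μ : Measure Ω} {m : ℕ}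
  [NormedAddCommGroup F] [InnerProductSpace ℝ F]
  {ε : ℤ → Ω → EuclideanSpace ℝ (Fin m)}
  {C : ℕ → EuclideanSpace ℝ (Fin m) →L[ℝ] F} {Y : ℤ → Ω → F}

theorem IsCausalFilter.memLp (h : IsCausalFilter μ C ε Y) (hε : IsWhiteNoise μ ε) (n : ℤ) :
    MemLp (Y n) 2 μ := by
  refine MemLp.ae_eq (EventuallyEq.symm (h n)) ?_
  exact memLp_finsetSum _ fun j _ => (C j).comp_memLp' (hε.memLp _)

variable [IsProbabilityMeasure μ]

theorem IsCausalFilter.integral_eq_zero [CompleteSpace F] (h : IsCausalFilter μ C ε Y)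
    (hε : IsWhiteNoise μ ε) (n : ℤ) : ∫ ω, Y n ω ∂μ = 0 := by
  have hi : ∀ n, Integrable (ε n) μ := fun n => (hε.memLp n).integrable (by norm_num)
  rw [integral_congr_ae (h n), integral_finsetSum _ fun j _ => (C j).integrable_comp (hi _)]
  refine Finset.sum_eq_zero fun j _ => ?_
  rw [(C j).integral_comp_comm (hi _), hε.mean, map_zero]

variable {S : EuclideanSpace ℝ (Fin m) →L[ℝ] EuclideanSpace ℝ (Fin m)}

/-- Only noise terms of equal date correlate: lag `j` at time `n` meets lag `j + k` at time `n + k`.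
The summand does not depend on `n`, so convergence of autocovariances is convergence of a series. -/
theorem IsCausalFilter.covariance_eq [CompleteSpace F] (h : IsCausalFilter μ C ε Y)
    (hε : IsWhiteNoise μ ε) (hS : IsNoiseCov μ ε S) (k : ℕ) (u v : F) (n : ℕ) :
    covariance (fun ω => inner ℝ u (Y ((n : ℤ) + k) ω)) (fun ω => inner ℝ v (Y n ω)) μ
      = ∑ j ∈ Finset.range n, inner ℝ ((C (j + k)).adjoint u) (S ((C j).adjoint v)) := by
  have hY : ∀ (u : F) (n : ℕ), (fun ω => inner ℝ u (Y n ω)) =ᵐ[μ]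
      fun ω => ∑ j ∈ Finset.range n, inner ℝ ((C j).adjoint u) (ε ((n : ℤ) - j) ω) := by
    intro u n
    filter_upwards [h n] with ω hω
    simp [hω, inner_sum, ContinuousLinearMap.adjoint_inner_left]
  have e : ((n : ℤ) + k) = ((n + k : ℕ) : ℤ) := by push_cast; rfl
  rw [e, covariance_congr_ae (hY u (n + k)) (hY v n), covariance_fun_sum_fun_sum'
    (fun j _ => hε.memLp_inner _ _) (fun j _ => hε.memLp_inner _ _), Finset.sum_comm]
  refine Finset.sum_congr rfl fun j hj => ?_
  rw [Finset.mem_range] at hj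
  rw [Finset.sum_eq_single (j + k)]
  · rw [hS.cov _ _ (by omega) (by omega), if_pos (by push_cast; ring)]
  · intro i hi hne
    rw [Finset.mem_range] at hi
    rw [hS.cov _ _ (by omega) (by omega), if_neg (by omega)]
  · intro hne
    exact absurd (Finset.mem_range.2 (by omega)) hne

theorem tendsto_int_atTop_iff {α : Type*} {f : ℤ → α} {l : Filter α} :
    Tendsto f atTop l ↔ Tendsto (fun n : ℕ => f n) atTop l := by
  rw [← Nat.map_cast_int_atTop, tendsto_map'_iff]
  rfl

theorem IsCausalFilter.isStationary [CompleteSpace F] (h : IsCausalFilter μ C ε Y)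
    (hε : IsWhiteNoise μ ε) (hC : Summable fun j => ‖C j‖) : IsStationaryProcess μ Y := by
  obtain ⟨S, hS⟩ := hε.exists_isNoiseCov
  refine ⟨h.memLp hε, ⟨0, by simp [h.integral_eq_zero hε]⟩, fun k u v => ?_⟩
  have hs : Summable fun j => inner ℝ ((C (j + k)).adjoint u) (S ((C j).adjoint v)) := by
    have hb : ∀ j, ‖C j‖ ≤ ∑' i, ‖C i‖ := fun j => hC.le_tsum j fun _ _ => norm_nonneg _
    refine Summable.of_norm_bounded
      (g := fun j => ((∑' i, ‖C i‖) * ‖u‖) * (‖S‖ * (‖C j‖ * ‖v‖)))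
      (((hC.mul_right ‖v‖).mul_left ‖S‖).mul_left _) fun j => ?_
    refine (norm_inner_le_norm _ _).trans (mul_le_mul ?_ ?_ (norm_nonneg _) (by positivity))
    · refine (((C (j + k)).adjoint).le_opNorm u).trans ?_
      rw [LinearIsometryEquiv.norm_map]
      gcongr
      exact hb _
    · refine (S.le_opNorm _).trans ?_
      gcongr
      refine (((C j).adjoint).le_opNorm v).trans ?_
      rw [LinearIsometryEquiv.norm_map]
  refine ⟨∑' j, inner ℝ ((C (j + k)).adjoint u) (S ((C j).adjoint v)),
    tendsto_int_atTop_iff.2 ?_⟩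
  simp only [h.covariance_eq hε hS]
  exact hs.hasSum.tendsto_sum_nat

/-- Convergent variances have increments tending to zero; these increments bound the squared
coefficients at `S y` by `inner_sq_le`. -/
theorem IsCausalFilter.tendsto_of_isStationary
    {C : ℕ → EuclideanSpace ℝ (Fin m) →L[ℝ] ℝ} {Y : ℤ → Ω → ℝ}
    (h : IsCausalFilter μ C ε Y) (hε : IsWhiteNoise μ ε) (hS : IsNoiseCov μ ε S)
    (hY : IsStationaryProcess μ Y) (y : EuclideanSpace ℝ (Fin m)) :
    Tendsto (fun j => C j (S y)) atTop (𝓝 0) := by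
  obtain ⟨γ, hγ⟩ := hY.2.2 0 1 1
  rw [tendsto_int_atTop_iff] at hγ
  simp only [h.covariance_eq hε hS, add_zero] at hγ
  have h1 := ((tendsto_add_atTop_iff_nat 1).2 hγ).sub hγ
  simp only [Finset.sum_range_succ, add_sub_cancel_left, sub_self] at h1
  have h2 : Tendsto (fun j => (C j (S y)) ^ 2) atTop (𝓝 0) := by
    refine squeeze_zero (fun j => sq_nonneg _) (fun j => ?_)
      (by simpa using h1.mul_const (inner ℝ y (S y)))
    have := hS.inner_sq_le hε ((C j).adjoint 1) y
    rw [ContinuousLinearMap.adjoint_inner_left] at this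
    simpa using this
  rw [tendsto_zero_iff_abs_tendsto_zero]
  have h3 := (Real.continuous_sqrt.tendsto 0).comp h2
  simpa [Function.comp_def, Real.sqrt_sq_eq_abs] using h3

theorem IsStationaryProcess.inner_left (hY : IsStationaryProcess μ Y) [CompleteSpace F] (v : F) :
    IsStationaryProcess μ fun n ω => inner ℝ v (Y n ω) := by
  obtain ⟨h1, ⟨a, ha⟩, h3⟩ := hY
  refine ⟨fun n => (innerSL ℝ v).comp_memLp' (h1 n), ⟨inner ℝ v a, ?_⟩, fun k s t => ?_⟩
  · have : ∀ n, ∫ ω, inner ℝ v (Y n ω) ∂μ = inner ℝ v (∫ ω, Y n ω ∂μ) := fun n =>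
      (innerSL ℝ v).integral_comp_comm ((h1 n).integrable (by norm_num))
    simp only [this]
    exact ((innerSL ℝ v).continuous.tendsto a).comp ha
  · obtain ⟨γ, hγ⟩ := h3 k v v
    refine ⟨s * (t * γ), ?_⟩
    have he : ∀ n : ℤ, covariance (fun ω => inner ℝ s (inner ℝ v (Y (n + k) ω)))
        (fun ω => inner ℝ t (inner ℝ v (Y n ω))) μ
        = s * (t * covariance (fun ω => inner ℝ v (Y (n + k) ω)) (fun ω => inner ℝ v (Y n ω)) μ) := by
      intro n
      simp only [real_inner_comm _ s, real_inner_comm _ t, RCLike.inner_apply, conj_trivial]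
      rw [covariance_const_mul_left, covariance_const_mul_right]
    simp only [he]
    exact (hγ.const_mul t).const_mul s

end Stationary

/-! ### Companion form and impulse responses. -/

section StateSpace

variable {E : Type*} [NormedAddCommGroup E] [NormedSpace ℝ E]

/-- The companion operator of a vector autoregression of order `p`, acting on the state
`(X_n, …, X_{n-p})`. -/
def companion (p : ℕ) (A : ℕ → E →L[ℝ] E) : (Fin (p + 1) → E) →L[ℝ] (Fin (p + 1) → E) :=
  ContinuousLinearMap.pi fun i => Fin.cases
    (motive := fun _ => (Fin (p + 1) → E) →L[ℝ] E)
    -- The last of the `p + 1` blocks is never read here; it ensures that block 0 exists even for `p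
    -- = 0`.
    (∑ k : Fin p, A (k + 1) ∘L ContinuousLinearMap.proj (R := ℝ) k.castSucc)
    (fun k => ContinuousLinearMap.proj (R := ℝ) k.castSucc) i

/-- The impulse responses of a vector autoregression. -/
def impulse (p : ℕ) (A : ℕ → E →L[ℝ] E) (j : ℕ) : E →L[ℝ] E :=
  ContinuousLinearMap.proj (R := ℝ) 0 ∘L (companion p A ^ j) ∘L
    ContinuousLinearMap.single ℝ (fun _ : Fin (p + 1) => E) 0

theorem impulse_apply (p : ℕ) (A : ℕ → E →L[ℝ] E) (j : ℕ) (x : E) :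
    impulse p A j x = (companion p A ^ j) (Pi.single 0 x) 0 := rfl

theorem companion_state (p : ℕ) (A : ℕ → E →L[ℝ] E) (x e : ℤ → E)
    (h : ∀ n, x n = ∑ j ∈ Finset.Icc 1 p, A j (x (n - j)) + e n) (n : ℤ) :
    (fun i : Fin (p + 1) => x (n - (i : ℕ)))
      = companion p A (fun i : Fin (p + 1) => x (n - 1 - (i : ℕ))) + Pi.single 0 (e n) := by
  funext i
  refine Fin.cases ?_ (fun k => ?_) i
  · have : ∑ j ∈ Finset.Icc 1 p, A j (x (n - j))
        = ∑ k : Fin p, A (k + 1) (x (n - 1 - (k : ℕ))) := by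
      rw [Finset.sum_fin_eq_sum_range, Finset.range_eq_Ico,
        ← Finset.Ico_succ_right_eq_Icc, Order.succ_eq_add_one, Finset.sum_Ico_eq_sum_range,
        Finset.range_eq_Ico, Nat.add_sub_cancel]
      refine Finset.sum_congr rfl fun k hk => ?_
      rw [dif_pos (Finset.mem_Ico.1 hk).2, add_comm 1 k]
      congr 2
      push_cast
      ring
    simp [companion, h n, this]
  · simp only [companion, Pi.add_apply, ContinuousLinearMap.pi_apply, Fin.cases_succ,
      ContinuousLinearMap.proj_apply, Fin.val_succ, Fin.val_castSucc, Pi.single_apply,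
      Fin.succ_ne_zero, if_false, add_zero]
    congr 1
    push_cast
    ring

/-- The state equation is iterated from the zero state at time 0. The statement is deterministic, to
be applied path by path. -/
theorem eq_sum_impulse (p : ℕ) (A : ℕ → E →L[ℝ] E) (x e : ℤ → E)
    (h : ∀ n, x n = ∑ j ∈ Finset.Icc 1 p, A j (x (n - j)) + e n) (h0 : ∀ n ≤ 0, x n = 0)
    (n : ℤ) : x n = ∑ j ∈ Finset.range n.toNat, impulse p A j (e (n - j)) := by
  have key : ∀ n : ℕ, (fun i : Fin (p + 1) => x ((n : ℤ) - (i : ℕ)))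
      = ∑ j ∈ Finset.range n, (companion p A ^ j) (Pi.single 0 (e ((n : ℤ) - j))) := by
    intro n
    induction n with
    | zero => funext i; simpa using h0 _ (by simp)
    | succ n ih =>
      rw [companion_state p A x e h, Finset.sum_range_succ']
      have e1 : ((n + 1 : ℕ) : ℤ) - 1 = n := by push_cast; ring
      rw [e1, ih, map_sum]
      simp only [pow_zero, Nat.cast_zero, sub_zero]
      congr 1
      refine Finset.sum_congr rfl fun j _ => ?_
      rw [pow_succ']
      have e2 : ((n + 1 : ℕ) : ℤ) - ((j + 1 : ℕ) : ℤ) = n - j := by push_cast; ring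
      rw [e2]
      rfl
  rcases le_or_gt n 0 with hn | hn
  · rw [h0 n hn, Int.toNat_of_nonpos hn, Finset.sum_range_zero]
  · obtain ⟨k, rfl⟩ := Int.eq_ofNat_of_zero_le hn.le
    have := congrFun (key k) 0
    simp only [Fin.val_zero, Nat.cast_zero, sub_zero, Finset.sum_apply] at this
    simpa [impulse_apply] using this

/-- Scalar impulse responses that tend to zero decay geometrically. -/
theorem geomDecay_impulse [FiniteDimensional ℝ E] (p : ℕ) (A : ℕ → E →L[ℝ] E)
    (f : E →L[ℝ] ℝ) (x : E) (h : Tendsto (fun j => f (impulse p A j x)) atTop (𝓝 0)) :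
    GeomDecay fun j => f (impulse p A j x) := by
  have e : ∀ j, f (impulse p A j x) = (f.toLinearMap ∘ₗ LinearMap.proj 0)
      (((companion p A).toLinearMap ^ j) (Pi.single 0 x)) := fun j => by
    rw [← ContinuousLinearMap.toLinearMap_pow]; rfl
  simp only [e] at h ⊢
  exact geomDecay_of_linearRecurrence _ _ _ h

/-- Differences of scalar impulse responses that tend to zero decay geometrically. -/
theorem geomDecay_diffCoeff_impulse [FiniteDimensional ℝ E] (p : ℕ) (A : ℕ → E →L[ℝ] E)
    (f : E →L[ℝ] ℝ) (x : E)
    (h : Tendsto (fun j => f (diffCoeff (impulse p A) j x)) atTop (𝓝 0)) :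
    GeomDecay fun j => f (diffCoeff (impulse p A) j x) := by
  -- Index 0 of `diffCoeff` is no difference. From index 1 on, the sequence is a functional composed
  -- with `companion p A - 1` along the same orbit, hence again a linear recurrence.
  refine GeomDecay.of_succ ?_
  have e : ∀ j, f (diffCoeff (impulse p A) (j + 1) x)
      = ((f.toLinearMap ∘ₗ LinearMap.proj 0) ∘ₗ ((companion p A).toLinearMap - 1))
      (((companion p A).toLinearMap ^ j) (Pi.single 0 x)) := fun j => by
    rw [← ContinuousLinearMap.toLinearMap_pow]
    change f (impulse p A (j + 1) x - impulse p A j x) = f _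
    rw [impulse_apply, impulse_apply, pow_succ']
    rfl
  have h' := (tendsto_add_atTop_iff_nat 1).2 h
  simp only [e] at h' ⊢
  exact geomDecay_of_linearRecurrence _ _ _ h'

end StateSpace

/-! ### Matrix coefficients and column spaces. -/

section Cointegration

variable {Ω : Type*} [MeasurableSpace Ω] {μ : Measure Ω} {m : ℕ}

theorem hasMARepresentation_of_isCausalFilter {ε Y : ℤ → Ω → EuclideanSpace ℝ (Fin m)}
    {C : ℕ → EuclideanSpace ℝ (Fin m) →L[ℝ] EuclideanSpace ℝ (Fin m)}
    (hε : IsWhiteNoise μ ε) (h : IsCausalFilter μ C ε Y) (hC : Summable fun j => ‖C j‖) :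
    HasMARepresentation μ (fun j => Matrix.toEuclideanLin.symm (C j).toLinearMap) ε Y := by
  refine ⟨fun a b => ?_, fun n => ?_⟩
  · refine hC.of_nonneg_of_le (fun _ => abs_nonneg _) fun j => ?_
    have e : Matrix.toEuclideanLin.symm (C j).toLinearMap a b
        = C j (EuclideanSpace.single b 1) a := by
      simp [Matrix.toEuclideanLin, Matrix.toLpLin, LinearMap.toMatrix'_apply]
    refine (congrArg abs e).trans_le ?_
    refine (PiLp.norm_apply_le (C j (EuclideanSpace.single b 1)) a).trans ?_
    simpa using (C j).le_opNorm (EuclideanSpace.single b 1)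
  · have h0 : ∀ᵐ ω ∂μ, ∀ k ≤ 0, ε k ω = 0 := by
      rw [ae_all_iff]
      intro k
      by_cases hk : k ≤ 0
      · filter_upwards [hε.start k hk] with ω hω _ using hω
      · exact Eventually.of_forall fun _ hk' => absurd hk' hk
    filter_upwards [h n, h0] with ω hω h0ω
    rw [hω]
    simp only [LinearEquiv.apply_symm_apply]
    -- The infinite sum is finite, as the noise vanishes at dates `n - j ≤ 0`.
    exact hasSum_sum_of_ne_finset_zero fun j hj => by
      rw [Finset.mem_range] at hj
      simp [h0ω (n - j) (by omega)]

theorem maSum_symm_toEuclideanLin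
    {C : ℕ → EuclideanSpace ℝ (Fin m) →L[ℝ] EuclideanSpace ℝ (Fin m)} (hC : Summable C)
    (x : EuclideanSpace ℝ (Fin m)) :
    (maSum fun j => Matrix.toEuclideanLin.symm (C j).toLinearMap).toEuclideanLin x
      = (∑' j, C j) x := by
  have : maSum (fun j => Matrix.toEuclideanLin.symm (C j).toLinearMap)
      = Matrix.toEuclideanLin.symm (∑' j, C j).toLinearMap := by
    let L : (EuclideanSpace ℝ (Fin m) →L[ℝ] EuclideanSpace ℝ (Fin m)) →ₗ[ℝ]
        Matrix (Fin m) (Fin m) ℝ :=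
      Matrix.toEuclideanLin.symm.toLinearMap ∘ₗ ContinuousLinearMap.coeLM ℝ
    ext a b
    let L' := Matrix.entryLinearMap ℝ ℝ a b ∘ₗ L
    exact ((LinearMap.toContinuousLinearMap L').map_tsum hC).symm
  rw [this, LinearEquiv.apply_symm_apply]
  rfl

theorem colSpace_eq_range_toEuclideanLin {k : ℕ} (B : Matrix (Fin m) (Fin k) ℝ) :
    colSpace B = LinearMap.range B.toEuclideanLin := by
  rw [colSpace]
  refine le_antisymm (Submodule.span_le.2 ?_) ?_
  · rintro _ ⟨j, rfl⟩
    refine ⟨EuclideanSpace.single j 1, ?_⟩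
    ext i
    simp [Matrix.toLpLin_apply]
  · rintro _ ⟨x, rfl⟩
    have : B.toEuclideanLin x = ∑ j, x j • WithLp.toLp 2 (B.col j) := by
      ext i
      simp [Matrix.toLpLin_apply, Matrix.mulVec, dotProduct, mul_comm]
    rw [this]
    exact sum_mem fun j _ => Submodule.smul_mem _ _ (Submodule.subset_span ⟨j, rfl⟩)

theorem finrank_colSpace {k : ℕ} (B : Matrix (Fin m) (Fin k) ℝ) :
    Module.finrank ℝ (colSpace B) = B.rank := by
  rw [colSpace_eq_range_toEuclideanLin, Matrix.rank_eq_finrank_range_toLin B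
    (PiLp.basisFun 2 ℝ (Fin m)) (PiLp.basisFun 2 ℝ (Fin k))]
  rw [Matrix.toEuclideanLin, Matrix.toLpLin_eq_toLin]

/-- Orthogonality gives one inclusion and a dimension count upgrades it to equality. -/
theorem colSpace_eq_orthogonal {r : ℕ} (β : Matrix (Fin m) (Fin r) ℝ)
    (βperp : Matrix (Fin m) (Fin (m - r)) ℝ) (hβ : Module.finrank ℝ (colSpace β) = r)
    (hrank : βperp.rank = m - r) (horth : β.transpose * βperp = 0) :
    colSpace βperp = (colSpace β)ᗮ := by
  refine Submodule.eq_of_le_of_finrank_eq ?_ ?_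
  · rw [colSpace, Submodule.span_le]
    rintro _ ⟨j, rfl⟩
    rw [SetLike.mem_coe, Submodule.mem_orthogonal]
    intro u hu
    induction hu using Submodule.span_induction with
    | mem u hu =>
      obtain ⟨i, rfl⟩ := hu
      have := congrFun (congrFun horth i) j
      simpa [Matrix.mul_apply, PiLp.inner_apply, mul_comm] using this
    | zero => simp
    | add u v _ _ hu hv => rw [inner_add_left, hu, hv, add_zero]
    | smul c u _ hu => rw [inner_smul_left, hu, mul_zero]
  · have := (colSpace β).finrank_add_finrank_orthogonal
    rw [finrank_euclideanSpace_fin, hβ] at this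
    rw [finrank_colSpace, hrank]
    omega

end Cointegration

/-! ### Coefficient decay under cointegration and the decomposition. -/

section Main

variable {m : ℕ}

theorem GeomDecay.of_inner {a : ℕ → EuclideanSpace ℝ (Fin m)}
    (h : ∀ v : EuclideanSpace ℝ (Fin m), GeomDecay fun n => (inner ℝ v (a n) : ℝ)) :
    GeomDecay a := by
  have e : a = fun n => ∑ i, a n i • EuclideanSpace.single i (1 : ℝ) := by
    funext n
    ext i
    simp [Pi.single_apply]
  rw [e]
  refine GeomDecay.sum _ fun i _ => (h (EuclideanSpace.single i 1)).of_norm_le 1 zero_le_one ?_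
  intro n
  simp [norm_smul, EuclideanSpace.inner_single_left]

theorem sum_Icc_one_eq_sum_range {E : Type*} [AddCommMonoid E] (e : ℤ → E) (n : ℕ) :
    ∑ i ∈ Finset.Icc 1 (n : ℤ), e i = ∑ j ∈ Finset.range n, e ((n : ℤ) - j) := by
  refine (Finset.sum_bij (fun j _ => (n : ℤ) - (j : ℕ)) ?_ ?_ ?_ ?_).symm
  · intro j hj
    rw [Finset.mem_range] at hj
    rw [Finset.mem_Icc]
    omega
  · intro i _ j _ h
    omega
  · intro i hi
    rw [Finset.mem_Icc] at hi
    exact ⟨(n - i).toNat, Finset.mem_range.2 (by omega), by omega⟩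
  · intro _ _
    rfl

variable {Ω : Type*} [MeasurableSpace Ω] {μ : Measure Ω}
  {X ε : ℤ → Ω → EuclideanSpace ℝ (Fin m)}

theorem IsVAR.exists_isCausalFilter {p : ℕ} (h : IsVAR μ p X ε)
    (h0 : ∀ n ≤ 0, ∀ᵐ ω ∂μ, X n ω = 0) :
    ∃ A : ℕ → EuclideanSpace ℝ (Fin m) →L[ℝ] EuclideanSpace ℝ (Fin m),
      IsCausalFilter μ (impulse p A) ε X := by
  obtain ⟨-, A, hA⟩ := h
  obtain ⟨A', hA'⟩ : ∃ A' : ℕ → EuclideanSpace ℝ (Fin m) →L[ℝ] EuclideanSpace ℝ (Fin m),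
      ∀ j x, A' j x = (A j).toEuclideanLin x :=
    ⟨fun j => LinearMap.toContinuousLinearMap (A j).toEuclideanLin, fun _ _ => rfl⟩
  simp only [← hA'] at hA
  refine ⟨A', fun n => ?_⟩
  have h0' : ∀ᵐ ω ∂μ, ∀ n ≤ 0, X n ω = 0 := by
    simpa only [ae_all_iff] using h0
  filter_upwards [ae_all_iff.2 hA, h0'] with ω h1 h2
  exact eq_sum_impulse p _ (fun n => X n ω) (fun n => ε n ω) h1 h2 n

theorem mem_cointegrationSpace_of_isStationary {v : EuclideanSpace ℝ (Fin m)}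
    (h : IsStationaryProcess μ fun n ω => inner ℝ v (X n ω)) : v ∈ cointegrationSpace μ X := by
  by_cases hv : v = 0
  · rw [hv]
    exact zero_mem _
  · exact Submodule.subset_span ⟨hv, h, fun _ _ => Nat.zero_le _⟩

variable [IsProbabilityMeasure μ]

variable {C : ℕ → EuclideanSpace ℝ (Fin m) →L[ℝ] EuclideanSpace ℝ (Fin m)}
  {S : EuclideanSpace ℝ (Fin m) →L[ℝ] EuclideanSpace ℝ (Fin m)}

/-- The limit is linear in `b`, so it passes from cointegration vectors to their span. -/
theorem IsCausalFilter.tendsto_inner_of_mem_cointegrationSpace (hX : IsCausalFilter μ C ε X)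
    (hε : IsWhiteNoise μ ε) (hS : IsNoiseCov μ ε S) {b : EuclideanSpace ℝ (Fin m)}
    (hb : b ∈ cointegrationSpace μ X) (y : EuclideanSpace ℝ (Fin m)) :
    Tendsto (fun j => (inner ℝ b (C j (S y)) : ℝ)) atTop (𝓝 0) := by
  induction hb using Submodule.span_induction with
  | mem b hb => exact (hX.map (innerSL ℝ b)).tendsto_of_isStationary hε hS hb.2.1 y
  | zero => simp
  | add u v _ _ hu hv => simpa [inner_add_left] using hu.add hv
  | smul c u _ hu => simpa [inner_smul_left] using hu.const_mul c

theorem IsCausalFilter.tendsto_inner_diffCoeff (hX : IsCausalFilter μ C ε X)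
    (hε : IsWhiteNoise μ ε) (hS : IsNoiseCov μ ε S)
    (hI : ∀ i : Fin m, IsIntegrated μ 1 fun n ω => X n ω i) (v y : EuclideanSpace ℝ (Fin m)) :
    Tendsto (fun j => (inner ℝ v (diffCoeff C j (S y)) : ℝ)) atTop (𝓝 0) := by
  have hi : ∀ i, Tendsto (fun j => diffCoeff C j (S y) i) atTop (𝓝 0) := fun i =>
    (hX.diffOp.map (EuclideanSpace.proj i)).tendsto_of_isStationary hε hS (hI i).1 y
  have := tendsto_finsetSum Finset.univ fun i _ => (hi i).const_mul (v i)
  simpa [PiLp.inner_apply, mul_comm] using this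

/-- Geometric decay of the coefficients of the stationary directions and of the differences, on the
support of the noise. -/
theorem IsCausalFilter.geomDecay_impulse {p : ℕ}
    {A : ℕ → EuclideanSpace ℝ (Fin m) →L[ℝ] EuclideanSpace ℝ (Fin m)}
    (hX : IsCausalFilter μ (impulse p A) ε X)
    (hε : IsWhiteNoise μ ε) (hS : IsNoiseCov μ ε S)
    (hI : ∀ i : Fin m, IsIntegrated μ 1 fun n ω => X n ω i)
    {B : Submodule ℝ (EuclideanSpace ℝ (Fin m))} (hB : B ≤ cointegrationSpace μ X) :
    (GeomDecay fun j => (B.starProjection ∘L impulse p A j) ∘L S.range.starProjection) ∧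
      GeomDecay fun j => diffCoeff (impulse p A) j ∘L S.range.starProjection := by
  -- Limits are known only at vectors `S y`; every projected vector has this form.
  have hrange : ∀ x, ∃ y, S y = S.range.starProjection x := fun x =>
    Submodule.starProjection_apply_mem S.range x
  refine ⟨GeomDecay.of_apply fun x => GeomDecay.of_inner fun v => ?_,
    GeomDecay.of_apply fun x => GeomDecay.of_inner fun v => ?_⟩
  · obtain ⟨y, hy⟩ := hrange x
    have := _root_.geomDecay_impulse p A (innerSL ℝ (B.starProjection v)) (S y)
      (hX.tendsto_inner_of_mem_cointegrationSpace hε hS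
        (hB (Submodule.starProjection_apply_mem B v)) y)
    simpa only [ContinuousLinearMap.comp_apply, ← hy, innerSL_apply_apply,
      Submodule.inner_starProjection_left_eq_right] using this
  · obtain ⟨y, hy⟩ := hrange x
    have := geomDecay_diffCoeff_impulse p A (innerSL ℝ v) (S y)
      (hX.tendsto_inner_diffCoeff hε hS hI v y)
    simpa only [ContinuousLinearMap.comp_apply, ← hy, innerSL_apply_apply] using this

omit [IsProbabilityMeasure μ] in
/-- The Beveridge–Nelson decomposition along complementary projections `P` and `Q`. -/
theorem IsCausalFilter.exists_decomposition (hX : IsCausalFilter μ C ε X)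
    {N P Q : EuclideanSpace ℝ (Fin m) →L[ℝ] EuclideanSpace ℝ (Fin m)}
    (hN : ∀ᵐ ω ∂μ, ∀ n, N (ε n ω) = ε n ω) (hPQ : ∀ x, P x + Q x = x) (hQP : ∀ x, Q (P x) = 0)
    (hd1 : GeomDecay fun j => (P ∘L C j) ∘L N) (hd2 : GeomDecay fun j => diffCoeff C j ∘L N) :
    ∃ (T R : ℕ → EuclideanSpace ℝ (Fin m) →L[ℝ] EuclideanSpace ℝ (Fin m))
      (η : ℤ → Ω → EuclideanSpace ℝ (Fin m)),
      (Summable fun j => ‖T j‖) ∧ (Summable fun j => ‖R j‖) ∧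
      (IsCausalFilter μ T ε fun n ω => P (X n ω) + Q (_root_.diffOp X n ω)) ∧
      IsCausalFilter μ R ε η ∧
      ∀ n : ℤ, 0 ≤ n → ∀ᵐ ω ∂μ,
        X n ω = Q ((∑' j, T j) (∑ i ∈ Finset.Icc 1 n, ε i ω)) + P (X n ω) + η n ω := by
  have hQQ : ∀ x, Q (Q x) = Q x := fun x => by
    have := congrArg Q (hPQ x)
    rwa [map_add, hQP, zero_add] at this
  obtain ⟨T, hTdef⟩ : ∃ T : ℕ → EuclideanSpace ℝ (Fin m) →L[ℝ] EuclideanSpace ℝ (Fin m),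
      T = fun j => (P ∘L C j + Q ∘L diffCoeff C j) ∘L N := ⟨_, rfl⟩
  have hT : GeomDecay T := by
    have := hd1.add (hd2.map (ContinuousLinearMap.compL ℝ _ _ _ Q))
    rw [hTdef]
    exact this
  have hTs : Summable T := hT.summable_norm.of_norm
  obtain ⟨R, hRdef⟩ : ∃ R : ℕ → EuclideanSpace ℝ (Fin m) →L[ℝ] EuclideanSpace ℝ (Fin m),
      R = fun j => -(Q ∘L ∑' k, T (k + (j + 1))) := ⟨_, rfl⟩
  have hR : GeomDecay R := by
    have := hT.tail.map (-(ContinuousLinearMap.compL ℝ _ _ _ Q))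
    rw [hRdef]
    exact this
  refine ⟨T, R, fun n ω => ∑ j ∈ Finset.range n.toNat, R j (ε (n - j) ω), hT.summable_norm,
    hR.summable_norm, ?_, fun n => Eventually.of_forall fun ω => rfl, fun n hn => ?_⟩
  · rw [hTdef]
    exact ((hX.map P).add (hX.diffOp.map Q)).comp_right N hN
  · obtain ⟨k, rfl⟩ := Int.eq_ofNat_of_zero_le hn
    -- Beveridge–Nelson at the level of coefficients: `Q` kills the `P` part of `T`, the differences
    -- telescope to `C j`, and `R j` is minus the tail beyond `j`.
    have hcoef : ∀ j x, Q (C j (N x)) = Q ((∑' i, T i) x) + R j x := by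
      intro j x
      have hQT : ∀ i, Q (T i x) = Q (diffCoeff C i (N x)) := fun i => by
        simp [hTdef, hQP, hQQ]
      rw [← hTs.sum_add_tsum_nat_add (j + 1), ← sum_diffCoeff C j]
      simp [hRdef, map_sum, hQT]
    filter_upwards [hX k, hN] with ω h1 h2
    have h3 : Q (X k ω) = Q ((∑' i, T i) (∑ i ∈ Finset.Icc 1 (k : ℤ), ε i ω))
        + ∑ j ∈ Finset.range k, R j (ε ((k : ℤ) - j) ω) := by
      rw [sum_Icc_one_eq_sum_range (fun i => ε i ω), map_sum, map_sum, ← Finset.sum_add_distrib]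
      simp only [← hcoef, h2]
      rw [h1, map_sum, Int.toNat_natCast]
    rw [Int.toNat_natCast, add_right_comm, ← h3, add_comm, hPQ]

theorem colProj_eq_self {k : ℕ} {B : Matrix (Fin m) (Fin k) ℝ} {x : EuclideanSpace ℝ (Fin m)}
    (hx : x ∈ colSpace B) : colProj B x = x :=
  Submodule.starProjection_eq_self_iff.2 hx

theorem inner_colProj_of_mem {k : ℕ} {B : Matrix (Fin m) (Fin k) ℝ}
    {v : EuclideanSpace ℝ (Fin m)} (hv : v ∈ colSpace B) (x : EuclideanSpace ℝ (Fin m)) :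
    (inner ℝ v (colProj B x) : ℝ) = inner ℝ v x := by
  rw [colProj, ← Submodule.inner_starProjection_left_eq_right, ← colProj, colProj_eq_self hv]

end Main

theorem mainTheorem2 {Ω : Type*} [MeasurableSpace Ω] (μ : Measure Ω) [IsProbabilityMeasure μ]
    (m p r : ℕ) (X ε : ℤ → Ω → EuclideanSpace ℝ (Fin m))
    (hX : CointegrationAssumption μ p r X ε)
    (β : Matrix (Fin m) (Fin r) ℝ) (hβ : colSpace β = cointegrationSpace μ X)
    (βperp : Matrix (Fin m) (Fin (m - r)) ℝ) (hrank : βperp.rank = m - r)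
    (horth : β.transpose * βperp = 0) :
    ∃ (θ θstar : ℕ → Matrix (Fin m) (Fin m) ℝ) (η : ℤ → Ω → EuclideanSpace ℝ (Fin m)),
      -- the moving average representation of `Z_n = P_β X_n + P_β⊥ ΔX_n`
      HasMARepresentation μ θ ε
        (fun n ω => colProj β (X n ω) + colProj βperp (diffOp X n ω)) ∧
      -- `η` is stationary, and in fact itself a moving average of the noise
      IsStationaryProcess μ η ∧ HasMARepresentation μ θstar ε η ∧
      -- the decomposition of `X`
      (∀ n : ℤ, 0 ≤ n → ∀ᵐ ω ∂μ,
        X n ω = colProj βperp ((maSum θ).toEuclideanLin (∑ i ∈ Finset.Icc 1 n, ε i ω))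
          + colProj β (X n ω) + η n ω) ∧
      -- `P_β X` is the stationary part of `X`
      IsStationaryProcess μ (fun n ω => colProj β (X n ω)) ∧
      (∀ v : EuclideanSpace ℝ (Fin m),
        IsStationaryProcess μ (fun n ω => inner ℝ v (X n ω)) ↔ v ∈ colSpace β) := by
  have hε := hX.isVAR.1
  obtain ⟨S, hS⟩ := hε.exists_isNoiseCov
  obtain ⟨A, hA⟩ := hX.isVAR.exists_isCausalFilter hX.start
  have hN := hS.ae_mem_range hε
  have hperp : colSpace βperp = (colSpace β)ᗮ :=
    colSpace_eq_orthogonal β βperp (by rw [hβ, hX.rank]) hrank horth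
  have hPQ : ∀ x, colProj β x + colProj βperp x = x := fun x => by
    simp only [colProj, hperp]
    exact Submodule.starProjection_add_starProjection_orthogonal x
  have hQP : ∀ x, colProj βperp (colProj β x) = 0 := fun x => by
    have h := hPQ (colProj β x)
    rwa [colProj_eq_self (B := β) (x := colProj β x) (Submodule.starProjection_apply_mem _ x),
      add_eq_left] at h
  obtain ⟨hd1, hd2⟩ := hA.geomDecay_impulse hε hS hX.isCI.2.1 hβ.le
  obtain ⟨T, R, η, hT, hR, hZ, hη, hdec⟩ := hA.exists_decomposition hN hPQ hQP hd1 hd2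
  have hPX : IsStationaryProcess μ fun n ω => colProj β (X n ω) :=
    ((hA.map (colProj β)).comp_right _ hN).isStationary hε hd1.summable_norm
  refine ⟨_, _, η, hasMARepresentation_of_isCausalFilter hε hZ hT,
    hη.isStationary hε hR, hasMARepresentation_of_isCausalFilter hε hη hR, fun n hn => ?_,
    hPX, fun v => ⟨fun h => hβ ▸ mem_cointegrationSpace_of_isStationary h, fun h => ?_⟩⟩
  · simp only [maSum_symm_toEuclideanLin hT.of_norm]
    exact hdec n hn
  -- For `v` in `Col β`, `v'X` equals `v'P_β X`, a functional of a stationary process.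
  · simpa only [inner_colProj_of_mem h] using hPX.inner_left v
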